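/- **Conventions.** A profinite completion of a topological group $S$ is a pair $(\operatorname{Prof}(S),\alpha_S)$ consisting of a profinite group (compact, Hausdorff, totally disconnected) and a continuous homomorphism $\alpha_S:S\to\operatorname{Prof}(S)$ with dense image such that every continuous homomorphism from $S$ to a profinite group $L$ factors through $\alpha_S$ by a continuous homomorphism $\operatorname{Prof}(S)\to L$. For a continuous unitary representation $\sigma:S\to U(n)$ with finite image, $\operatorname{Prof}(\sigma):\operatorname{Prof}(S)\to U(n)$ denotes the continuous homomorphism with $\operatorname{Prof}(\sigma)\circ\alpha_S=\sigma$. For topological groups, $\cong$ means topologically isomorphic. **Theorem.** Let $G=N\rtimes H$ be a locally compact (Hausdorff) group which is the topological semidirect product of a closed normal subgroup $N$ and a closed subgroup $H$ (i.e. multiplication $N\times H\to G$ is a homeomorphism). Let $(\operatorname{Prof}(G),\alpha_G)$, $(\operatorname{Prof}(N),\alpha_N)$, $(\operatorname{Prof}(H),\alpha_H)$ be profinite completions of $G$, $N$, $H$. Let $\psi_N:\operatorname{Prof}(N)\to\overline{\alpha_G(N)}$ and $\psi_H:\operatorname{Prof}(H)\to\overline{\alpha_G(H)}$ be the continuous homomorphisms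 with $\psi_N\circ\alpha_N=\alpha_G|_N$ and $\psi_H\circ\alpha_H=\alpha_G|_H$. Let $\widehat N_{\rm finite}^{H-{\rm per}}$ be the set of equivalence classes (modulo unitary equivalence) of irreducible finite-dimensional unitary representations $\sigma$ of $N$ with finite image whose orbit under the action $\sigma^h(n)=\sigma(h^{-1}nh)$ of $H$ on equivalence classes is finite, and set $$D:=\bigcap_{\sigma\in\widehat N_{\rm finite}^{H-{\rm per}}}\operatorname{Ker}(\operatorname{Prof}(\sigma))\subset\operatorname{Prof}(N).$$ (i) $\operatorname{Ker}\psi_N=D$, and $\psi_N$ induces a topological isomorphism $\overline{\psi_N}:\operatorname{Prof}(N)/D\to\overline{\alpha_G(N)}$. (ii) $\psi_H:\operatorname{Prof}(H)\to\overline{\alpha_G(H)}$ is a topological isomorphism. (iii) Let $H$ act on $\operatorname{Prof}(N)$ by the continuous automorphisms $\theta(h)$ with $\theta(h)(\alpha_N(n))=\alpha_N(hnh^{-1})$ for $n\in N$. Then $D$ is $H$-invariant, and the action of $H$ on $\operatorname{Prof}(N)/D$ induces a continuous action $\widehat\theta$ of $\operatorname{Prof}(H)$ on $\operatorname{Prof}(N)/D$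 by automorphisms, with $\widehat\theta(\alpha_H(h))(xD)=\theta(h)(x)D$ for all $h\in H$, $x\in\operatorname{Prof}(N)$. For this action, the map $$(\operatorname{Prof}(N)/D)\rtimes\operatorname{Prof}(H)\to\operatorname{Prof}(G),\qquad (xD,y)\mapsto\psi_N(x)\psi_H(y)$$ is an isomorphism of topological groups; in particular $\operatorname{Prof}(G)\cong(\operatorname{Prof}(N)/D)\rtimes\operatorname{Prof}(H)$. -/

import Mathlib

universe u v

/-- A profinite group: a compact, Hausdorff, totally disconnected topological group. -/
class IsProfiniteGroup (K : Type u) [Group K] [TopologicalSpace K] : Prop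
    extends IsTopologicalGroup K, CompactSpace K, T2Space K, TotallyDisconnectedSpace K

/-- `(K, α)` is a profinite completion of the topological group `G`: `K` is a profinite group,
`α : G → K` is a continuous homomorphism with dense image, and every continuous homomorphism
from `G` to a profinite group factors through `α` by a continuous homomorphism. -/
structure IsProfiniteCompletion {G K : Type u} [Group G] [TopologicalSpace G]
    [Group K] [TopologicalSpace K] (α : G →ₜ* K) : Prop where
  profinite : IsProfiniteGroup K
  denseRange : DenseRange α
  exists_lift : ∀ (L : Type u) [Group L] [TopologicalSpace L] [IsProfiniteGroup L]
    (f : G →ₜ* L), ∃ f' : K →ₜ* L, ∀ g, f' (α g) = f g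

section ProfiniteCompletion

variable {G K L : Type u} [Group G] [TopologicalSpace G] [Group K] [TopologicalSpace K]
  [Group L] [TopologicalSpace L]

/-- Continuous homomorphisms out of a profinite completion are determined on `G`. -/
theorem IsProfiniteCompletion.hom_ext {α : G →ₜ* K} (hα : IsProfiniteCompletion α)
    {M : Type v} [Group M] [TopologicalSpace M] [T2Space M] {f f' : K →ₜ* M}
    (h : ∀ g, f (α g) = f' (α g)) : f = f' :=
  DFunLike.coe_injective
    (hα.denseRange.equalizer (map_continuous f) (map_continuous f') (funext h))

/-- The continuous homomorphism `K → L` induced by `f : G → L`, for a profinite group `L`. -/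
noncomputable def IsProfiniteCompletion.lift {α : G →ₜ* K} (hα : IsProfiniteCompletion α)
    [IsProfiniteGroup L] (f : G →ₜ* L) : K →ₜ* L :=
  (hα.exists_lift L f).choose

theorem IsProfiniteCompletion.lift_apply {α : G →ₜ* K} (hα : IsProfiniteCompletion α)
    [IsProfiniteGroup L] (f : G →ₜ* L) (g : G) : hα.lift f (α g) = f g :=
  (hα.exists_lift L f).choose_spec g

/-- Every topological group has a profinite completion: the closure of the image of `G` in the
product of the quotients of `G` by its open normal subgroups of finite index. -/
theorem exists_isProfiniteCompletion (G : Type u) [Group G] [TopologicalSpace G]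
    [IsTopologicalGroup G] :
    ∃ (K : Type u) (_ : Group K) (_ : TopologicalSpace K) (α : G →ₜ* K),
      IsProfiniteCompletion α := by
  let I := {U : Subgroup G // U.Normal ∧ IsOpen (U : Set G) ∧ U.FiniteIndex}
  have hn (i : I) : i.1.Normal := i.2.1
  have hd (i : I) : DiscreteTopology (G ⧸ i.1) := QuotientGroup.discreteTopology i.2.2.1
  have hf (i : I) : Finite (G ⧸ i.1) := have := i.2.2.2; inferInstance
  let d : G →ₜ* (∀ i : I, G ⧸ i.1) :=
    { toFun := fun g i => (g : G ⧸ i.1)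
      map_one' := rfl
      map_mul' := fun _ _ => rfl
      continuous_toFun := continuous_pi fun i => continuous_quotient_mk' }
  let K : Subgroup (∀ i : I, G ⧸ i.1) := d.toMonoidHom.range.topologicalClosure
  have hK : CompactSpace K :=
    isCompact_iff_compactSpace.mp (Subgroup.isClosed_topologicalClosure _).isCompact
  let α : G →ₜ* K :=
    { toFun := fun g => ⟨d g, Subgroup.le_topologicalClosure _ ⟨g, rfl⟩⟩
      map_one' := rfl
      map_mul' := fun _ _ => rfl
      continuous_toFun := (map_continuous d).subtype_mk _ }
  have hα : DenseRange α := by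
    rw [DenseRange, Subtype.dense_iff]
    intro x hx
    have : Subtype.val '' Set.range α = (d.toMonoidHom.range : Set (∀ i : I, G ⧸ i.1)) := by
      rw [← Set.range_comp]; rfl
    exact (congrArg closure this).symm ▸ hx
  refine ⟨K, inferInstance, inferInstance, α, { }, hα, fun L _ _ _ f => ?_⟩
  let R : Subgroup (K × L) := (α.prod f).toMonoidHom.range.topologicalClosure
  have hRc : IsClosed (R : Set (K × L)) := Subgroup.isClosed_topologicalClosure _
  have hR : CompactSpace R := isCompact_iff_compactSpace.mp hRc.isCompact
  have hmem (g : G) : (α g, f g) ∈ R := Subgroup.le_topologicalClosure _ ⟨g, rfl⟩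
  let p : R →* K := (MonoidHom.fst K L).comp R.subtype
  have hp : Continuous p := continuous_fst.comp continuous_subtype_val
  have hpinj : Function.Injective p := by
    rw [injective_iff_map_eq_one]
    rintro ⟨⟨k, z⟩, hz⟩ (hk : k = 1)
    subst hk
    have hz1 : z = 1 := by
      by_contra hne
      obtain ⟨V, hV⟩ := ProfiniteGrp.exist_openNormalSubgroup_sub_open_nhds_of_one
        (G := L) (isOpen_compl_singleton (x := z)) (by simpa using Ne.symm hne)
      have hVf : V.toSubgroup.FiniteIndex := Subgroup.finiteIndex_of_finite_quotient
      have hfin : (V.toSubgroup.comap f.toMonoidHom).FiniteIndex := by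
        refine ⟨?_⟩
        rw [Subgroup.index_comap]
        exact Subgroup.FiniteIndex.index_ne_zero (H := V.toSubgroup.subgroupOf f.toMonoidHom.range)
      let i : I := ⟨V.toSubgroup.comap f.toMonoidHom, inferInstance,
        V.isOpen'.preimage (map_continuous f), hfin⟩
      let C : Set (K × L) := {q | q.1.1 i = 1 → q.2 ∈ (V : Set L)}
      have hC : IsClosed C := by
        have h1 : IsOpen {q : K × L | q.1.1 i = 1} :=
          (isOpen_discrete ({1} : Set (G ⧸ i.1))).preimage (f := fun q : K × L => q.1.1 i)
            ((continuous_apply (A := fun i : I => G ⧸ i.1) i).comp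
              (continuous_subtype_val.comp continuous_fst))
        have h2 : IsClosed {q : K × L | q.2 ∈ (V : Set L)} :=
          (V.toOpenSubgroup.isClosed).preimage continuous_snd
        exact isClosed_imp h1 h2
      have hsub : (R : Set (K × L)) ⊆ C := by
        refine closure_minimal ?_ hC
        rintro _ ⟨g, rfl⟩ (hg : ((g : G) : G ⧸ i.1) = 1)
        exact (QuotientGroup.eq_one_iff g).mp hg
      exact hV (hsub hz rfl) rfl
    subst hz1
    rfl
  have hpsurj : Function.Surjective p := by
    rw [← Set.range_eq_univ, ← (isCompact_range hp).isClosed.closure_eq]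
    exact (hα.mono (by rintro _ ⟨g, rfl⟩; exact ⟨⟨_, hmem g⟩, rfl⟩)).closure_eq
  let e : R ≃* K := MulEquiv.ofBijective p ⟨hpinj, hpsurj⟩
  let h : R ≃ₜ K := hp.homeoOfEquivCompactToT2 (f := e.toEquiv)
  have hsymm : Continuous e.symm := h.continuous_symm
  refine ⟨{ toMonoidHom := ((MonoidHom.snd K L).comp R.subtype).comp e.symm.toMonoidHom
            continuous_toFun := continuous_snd.comp (continuous_subtype_val.comp hsymm) },
    fun g => ?_⟩
  change (e.symm (α g)).1.2 = f g
  have : e.symm (α g) = ⟨_, hmem g⟩ := by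
    rw [MulEquiv.symm_apply_eq]; rfl
  rw [this]

end ProfiniteCompletion

/-! ### Finite-dimensional unitary representations -/

/-- Unitary representations of `N` on `ℂⁿ`: continuous homomorphisms `N → U(n)`. -/
abbrev UnitaryRep (N : Type u) [Group N] [TopologicalSpace N] (n : ℕ) :=
  N →ₜ* Matrix.unitaryGroup (Fin n) ℂ

namespace UnitaryRep

variable {N : Type u} [Group N] [TopologicalSpace N] {n : ℕ}

/-- The linear representation on `ℂⁿ` underlying a unitary representation. -/
noncomputable def toRepresentation (σ : UnitaryRep N n) : Representation ℂ N (Fin n → ℂ) :=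
  ((Matrix.toLinAlgEquiv' : Matrix (Fin n) (Fin n) ℂ ≃ₐ[ℂ] _) : _ →* _).comp
    ((Matrix.unitaryGroup (Fin n) ℂ).subtype.comp σ.toMonoidHom)

/-- Unitary equivalence of representations. -/
def setoid (N : Type u) [Group N] [TopologicalSpace N] (n : ℕ) : Setoid (UnitaryRep N n) where
  r σ τ := ∃ U : Matrix.unitaryGroup (Fin n) ℂ, ∀ x, U * σ x * U⁻¹ = τ x
  iseqv :=
    { refl := fun σ => ⟨1, fun x => by simp⟩
      symm := by
        rintro σ τ ⟨U, hU⟩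
        exact ⟨U⁻¹, fun x => by rw [← hU]; group⟩
      trans := by
        rintro σ τ ρ ⟨U, hU⟩ ⟨V, hV⟩
        exact ⟨V * U, fun x => by rw [← hV, ← hU]; group⟩ }

/-- If `σ` is a unitary representation of `N` with finite image and `(P, α)` is a profinite
completion of `N`, then `σ` extends to a continuous homomorphism `P → U(n)`. -/
theorem exists_extension {P : Type u} [Group P] [TopologicalSpace P] {α : N →ₜ* P}
    (hα : IsProfiniteCompletion α) (σ : UnitaryRep N n) (hσ : (Set.range σ).Finite) :
    ∃ σ' : UnitaryRep P n, ∀ x, σ' (α x) = σ x := by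
  let R : Subgroup (Matrix.unitaryGroup (Fin n) ℂ) := σ.toMonoidHom.range
  have hR : Finite R := hσ.to_subtype
  have : IsTopologicalGroup R := inferInstance
  have : IsTopologicalGroup (ULift.{u} R) := inferInstance
  have : Finite (ULift.{u} R) := inferInstance
  have : DiscreteTopology (ULift.{u} R) := inferInstance
  have : IsProfiniteGroup (ULift.{u} R) := { }
  let f : N →ₜ* ULift.{u} R :=
    { toFun := fun x => ⟨⟨σ x, x, rfl⟩⟩
      map_one' := by ext1; ext1; exact map_one σ
      map_mul' := fun x y => by ext1; ext1; exact map_mul σ x y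
      continuous_toFun := continuous_uliftUp.comp ((map_continuous σ).subtype_mk _) }
  let down : ULift.{u} R →ₜ* Matrix.unitaryGroup (Fin n) ℂ :=
    { toFun := fun x => x.down
      map_one' := rfl
      map_mul' := fun _ _ => rfl
      continuous_toFun := continuous_subtype_val.comp continuous_uliftDown }
  refine ⟨down.comp (hα.lift f), fun x => ?_⟩
  change down (hα.lift f (α x)) = σ x
  rw [hα.lift_apply]
  rfl

/-- `Prof(σ)`, the unitary representation of the profinite completion of `N` that extends the
unitary representation `σ` with finite image; it is characterized by `Prof(σ) ∘ α = σ`. -/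
noncomputable def prof {P : Type u} [Group P] [TopologicalSpace P] {α : N →ₜ* P}
    (hα : IsProfiniteCompletion α) (σ : UnitaryRep N n) (hσ : (Set.range σ).Finite) :
    UnitaryRep P n :=
  (exists_extension hα σ hσ).choose

theorem prof_apply {P : Type u} [Group P] [TopologicalSpace P] {α : N →ₜ* P}
    (hα : IsProfiniteCompletion α) (σ : UnitaryRep N n) (hσ : (Set.range σ).Finite) (x : N) :
    prof hα σ hσ (α x) = σ x :=
  (exists_extension hα σ hσ).choose_spec x

end UnitaryRep

/-! ### Semidirect products -/

/-- The product topology on a semidirect product. -/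
instance SemidirectProduct.instTopologicalSpaceProd {N : Type u} {H : Type v} [Group N] [Group H]
    [TopologicalSpace N] [TopologicalSpace H] (φ : H →* MulAut N) :
    TopologicalSpace (N ⋊[φ] H) :=
  TopologicalSpace.induced (fun a => (a.left, a.right)) inferInstance

section Extension

variable {G : Type u} [Group G] [TopologicalSpace G]

/-- The topological group `G` is the (topological) semidirect product of its closed normal subgroup
`N` and its closed subgroup `H`: multiplication `N × H → G` is a homeomorphism. -/
structure IsTopologicalSemidirectProduct (N H : Subgroup G) : Prop where
  normal : N.Normal
  isClosed_left : IsClosed (N : Set G)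
  isClosed_right : IsClosed (H : Set G)
  isHomeomorph : IsHomeomorph (fun p : N × H => (p.1 : G) * (p.2 : G))

variable [IsTopologicalGroup G]

/-- Conjugation `x ↦ g x g⁻¹` on a normal subgroup. -/
def conjHom (N : Subgroup G) [N.Normal] (g : G) : N →ₜ* N where
  toMonoidHom := (MulAut.conjNormal g : N ≃* N).toMonoidHom
  continuous_toFun := by
    refine Continuous.subtype_mk (f := fun x : N => g * x * g⁻¹) ?_ _
    fun_prop

theorem conjHom_apply (N : Subgroup G) [N.Normal] (g : G) (x : N) :
    (conjHom N g x : G) = g * x * g⁻¹ := rfl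

/-- The conjugate representation `σ^g`, given by `σ^g(x) = σ(g⁻¹ x g)`. -/
noncomputable def UnitaryRep.conj {N : Subgroup G} [N.Normal] {n : ℕ} (σ : UnitaryRep N n) (g : G) :
    UnitaryRep N n :=
  σ.comp (conjHom N g⁻¹)

/-- The irreducible unitary representations `σ` of `N` (on some `ℂⁿ`) with finite image and such
that the `H`-orbit of the equivalence class of `σ` is finite. -/
structure FinitePeriodicIrrep (N H : Subgroup G) [N.Normal] where
  dim : ℕ
  rep : UnitaryRep N dim
  irreducible : rep.toRepresentation.IsIrreducible
  finite_image : (Set.range rep).Finite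
  finite_orbit :
    (Set.range fun h : H => (Quotient.mk (UnitaryRep.setoid N dim) (rep.conj (h : G)))).Finite

section

variable {PN : Type u} [Group PN] [TopologicalSpace PN]

/-- The subgroup `D` of `Prof(N)`: the intersection of the kernels of `Prof(σ)` over all
irreducible unitary representations `σ` of `N` with finite image and finite `H`-orbit. -/
noncomputable def periodicKernel {N : Subgroup G} [N.Normal] (H : Subgroup G) {αN : N →ₜ* PN}
    (hN : IsProfiniteCompletion αN) : Subgroup PN :=
  ⨅ σ : FinitePeriodicIrrep N H, (UnitaryRep.prof hN σ.rep σ.finite_image).toMonoidHom.ker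

instance periodicKernel_normal {N : Subgroup G} [N.Normal] (H : Subgroup G) {αN : N →ₜ* PN}
    (hN : IsProfiniteCompletion αN) : (periodicKernel H hN).Normal :=
  Subgroup.normal_iInf_normal fun _ => inferInstance

/-- The continuous endomorphism of `Prof(N)` induced by conjugation with `g`. -/
noncomputable def profConj {N : Subgroup G} [N.Normal] [IsProfiniteGroup PN] {αN : N →ₜ* PN}
    (hN : IsProfiniteCompletion αN) (g : G) : PN →ₜ* PN :=
  hN.lift (αN.comp (conjHom N g))

theorem profConj_apply {N : Subgroup G} [N.Normal] [IsProfiniteGroup PN] {αN : N →ₜ* PN}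
    (hN : IsProfiniteCompletion αN) (g : G) (x : N) :
    profConj hN g (αN x) = αN (conjHom N g x) :=
  hN.lift_apply _ x

theorem profConj_one {N : Subgroup G} [N.Normal] [IsProfiniteGroup PN] {αN : N →ₜ* PN}
    (hN : IsProfiniteCompletion αN) : profConj hN 1 = ContinuousMonoidHom.id PN := by
  refine hN.hom_ext fun x => ?_
  rw [profConj_apply]
  change αN _ = αN x
  congr 1
  ext1
  simp [conjHom_apply]

theorem profConj_mul {N : Subgroup G} [N.Normal] [IsProfiniteGroup PN] {αN : N →ₜ* PN}
    (hN : IsProfiniteCompletion αN) (g g' : G) :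
    profConj hN (g * g') = (profConj hN g).comp (profConj hN g') := by
  refine hN.hom_ext fun x => ?_
  change _ = profConj hN g (profConj hN g' (αN x))
  rw [profConj_apply, profConj_apply, profConj_apply]
  congr 1
  ext1
  simp [conjHom_apply, mul_assoc]

/-- The action `θ` of `H` on `Prof(N)` by automorphisms (continuous, see
`continuous_profAction`), characterized by `θ(h)(α_N(x)) = α_N(h x h⁻¹)`. -/
noncomputable def profAction {N : Subgroup G} [N.Normal] (H : Subgroup G) [IsProfiniteGroup PN]
    {αN : N →ₜ* PN} (hN : IsProfiniteCompletion αN) : H →* MulAut PN where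
  toFun h :=
    { toFun := profConj hN (h : G)
      invFun := profConj hN (h : G)⁻¹
      left_inv := fun x => by
        have := DFunLike.congr_fun (profConj_mul hN (h : G)⁻¹ (h : G)) x
        rw [inv_mul_cancel, profConj_one] at this
        exact this.symm
      right_inv := fun x => by
        have := DFunLike.congr_fun (profConj_mul hN (h : G) (h : G)⁻¹) x
        rw [mul_inv_cancel, profConj_one] at this
        exact this.symm
      map_mul' := map_mul _ }
  map_one' := by
    ext x
    exact DFunLike.congr_fun (profConj_one hN) x
  map_mul' h h' := by
    ext x
    exact DFunLike.congr_fun (profConj_mul hN (h : G) (h' : G)) x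

theorem profAction_apply {N : Subgroup G} [N.Normal] (H : Subgroup G) [IsProfiniteGroup PN]
    {αN : N →ₜ* PN} (hN : IsProfiniteCompletion αN) (h : H) (x : N) :
    profAction H hN h (αN x) = αN (conjHom N (h : G) x) :=
  profConj_apply hN (h : G) x

theorem continuous_profAction {N : Subgroup G} [N.Normal] (H : Subgroup G) [IsProfiniteGroup PN]
    {αN : N →ₜ* PN} (hN : IsProfiniteCompletion αN) (h : H) :
    Continuous (profAction H hN h) :=
  map_continuous (profConj hN (h : G))

end

/-! ### The closure of the image of a subgroup in `Prof(G)` -/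

variable {PG : Type u} [Group PG] [TopologicalSpace PG] [IsProfiniteGroup PG]

/-- The closure of `α(S)`. -/
def closureImage (α : G →ₜ* PG) (S : Subgroup G) : Subgroup PG :=
  (S.map α.toMonoidHom).topologicalClosure

instance closureImage_isProfiniteGroup (α : G →ₜ* PG) (S : Subgroup G) :
    IsProfiniteGroup (closureImage α S) :=
  have : CompactSpace (closureImage α S) :=
    isCompact_iff_compactSpace.mp (Subgroup.isClosed_topologicalClosure _).isCompact
  { }

/-- The restriction of `α` to `S`, as a map to the closure of `α(S)`. -/
def restrictToClosure (α : G →ₜ* PG) (S : Subgroup G) : S →ₜ* closureImage α S where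
  toFun s := ⟨α s, Subgroup.le_topologicalClosure _ ⟨s, s.2, rfl⟩⟩
  map_one' := Subtype.ext (map_one α)
  map_mul' s t := Subtype.ext (map_mul α (s : G) (t : G))
  continuous_toFun := ((map_continuous α).comp continuous_subtype_val).subtype_mk _

/-- The map `ψ_S : Prof(S) → closure of α_G(S)` characterized by `ψ_S ∘ α_S = α_G|_S`. -/
noncomputable def psi {S : Subgroup G} {PS : Type u} [Group PS] [TopologicalSpace PS]
    {αS : S →ₜ* PS} (hS : IsProfiniteCompletion αS) (α : G →ₜ* PG) : PS →ₜ* closureImage α S :=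
  hS.lift (restrictToClosure α S)

theorem psi_apply {S : Subgroup G} {PS : Type u} [Group PS] [TopologicalSpace PS]
    {αS : S →ₜ* PS} (hS : IsProfiniteCompletion αS) (α : G →ₜ* PG) (s : S) :
    (psi hS α (αS s) : PG) = α s :=
  congrArg Subtype.val (hS.lift_apply (restrictToClosure α S) s)

end Extension

/-!
Let `V` be an open normal subgroup of `Prof(N)` whose preimage `U` in `N` is invariant under `H`.
The irreducible constituents of the permutation representation of `N` on `ℂ[N/U]` separate the
points of `N/U`. Their `H`-conjugates are again trivial on `U` with unchanged image, so each of them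
has a finite `H`-orbit; hence `D ≤ V`. Preimages of open normal subgroups of `Prof(G)` are of this
kind and intersect in `Ker ψ_N`, so `D ≤ Ker ψ_N`. Conversely, if `σ` has finite image and finite
`H`-orbit, the common kernel `U` of its `H`-conjugates is open, `H`-invariant and of finite index.
Then `UH` is an open subgroup of finite index of `G` meeting `N` in `U`, and the quotient of `G` by
its normal core is a finite quotient in which `σ` can be read off; hence `Ker ψ_N ≤ Ker Prof(σ)`.

The retraction `G → H` induces a homomorphism `Prof(G) → Prof(H)` which is left inverse to `ψ_H` and
kills the closure of `α_G(N)`. So `ψ_H` is injective and `Prof(G)`, being compact, is the internal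
semidirect product of the closures of `α_G(N)` and `α_G(H)`.
-/

section Topology

theorem surjective_of_continuous_of_denseRange {X Y : Type*} [TopologicalSpace X] [CompactSpace X]
    [TopologicalSpace Y] [T2Space Y] {f : X → Y} (hf : Continuous f) (hd : DenseRange f) :
    Function.Surjective f := by
  rw [← Set.range_eq_univ, ← (isCompact_range hf).isClosed.closure_eq, hd.closure_range]

theorem subset_of_preimage_subset_of_denseRange {S P : Type*} [TopologicalSpace P] {α : S → P}
    (hα : DenseRange α) {V K : Set P} (hV : IsOpen V) (hK : IsClosed K)
    (h : α ⁻¹' V ⊆ α ⁻¹' K) : V ⊆ K :=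
  (hα.open_subset_closure_inter hV).trans
    (closure_minimal (by rintro _ ⟨hs, s, rfl⟩; exact h hs) hK)

/-- A continuous bijective homomorphism from a compact group to a Hausdorff group, as an
isomorphism of topological groups. -/
noncomputable def continuousMulEquivOfBijective {A B : Type*} [Group A] [TopologicalSpace A]
    [CompactSpace A] [Group B] [TopologicalSpace B] [T2Space B] (f : A →ₜ* B)
    (hf : Function.Bijective f) : A ≃ₜ* B where
  toMulEquiv := MulEquiv.ofBijective f hf
  continuous_toFun := map_continuous f
  continuous_invFun := Continuous.continuous_symm_of_equiv_compact_to_t2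
    (f := Equiv.ofBijective f hf) (map_continuous f)

theorem eq_one_of_forall_mem_openNormalSubgroup {P : Type*} [Group P] [TopologicalSpace P]
    [IsTopologicalGroup P] [CompactSpace P] [T2Space P] [TotallyDisconnectedSpace P] {x : P}
    (hx : ∀ V : OpenNormalSubgroup P, x ∈ V) : x = 1 := by
  by_contra hne
  obtain ⟨V, hV⟩ := ProfiniteGrp.exist_openNormalSubgroup_sub_open_nhds_of_one
    (isOpen_compl_singleton (x := x)) (Ne.symm hne)
  exact hV (hx V) rfl

end Topology

section InternalSemidirectProduct

variable {P A B : Type*} [Group P] [TopologicalSpace P] [Group A] [TopologicalSpace A] [Group B]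
  [TopologicalSpace B] {M : Subgroup P} [M.Normal]

/-- The action of `B` on a copy `A` of the normal subgroup `M` of `P` by conjugation through a
homomorphism `B → P`. -/
def conjAction (e : A ≃ₜ* M) (s : B →ₜ* P) : B →* MulAut A :=
  (MulAut.congr e.toMulEquiv.symm).toMonoidHom.comp (MulAut.conjNormal.comp s.toMonoidHom)

variable {e : A ≃ₜ* M} {s : B →ₜ* P}

theorem coe_conjAction_apply (b : B) (a : A) : (e (conjAction e s b a) : P) = s b * e a * (s b)⁻¹ :=
  congrArg Subtype.val (e.apply_symm_apply (MulAut.conjNormal (s b) (e a)))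

theorem continuous_conjAction [IsTopologicalGroup P] :
    Continuous fun p : B × A => conjAction e s p.1 p.2 := by
  have continuous_conj : Continuous fun p : B × A => s p.1 * e p.2 * (s p.1)⁻¹ := by fun_prop
  exact e.symm.continuous.comp <| continuous_conj.subtype_mk fun p =>
    Subgroup.Normal.conj_mem inferInstance _ (e p.2).2 _

instance compactSpace_semidirectProduct [CompactSpace A] [CompactSpace B] (φ : B →* MulAut A) :
    CompactSpace (A ⋊[φ] B) :=
  (Equiv.toHomeomorphOfIsInducing SemidirectProduct.equivProd ⟨rfl⟩).symm.compactSpace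

/-- The multiplication homomorphism `(a, b) ↦ e a * s b` of the semidirect product. -/
def semidirectProductHom [IsTopologicalGroup P] (e : A ≃ₜ* M) (s : B →ₜ* P) :
    A ⋊[conjAction e s] B →ₜ* P where
  toMonoidHom := SemidirectProduct.lift (M.subtype.comp e.toMulEquiv.toMonoidHom) s.toMonoidHom
    fun b => MonoidHom.ext fun a => coe_conjAction_apply (e := e) (s := s) b a
  continuous_toFun := by
    have continuous_prod : Continuous fun p : A × B => (e p.1 : P) * s p.2 := by fun_prop
    exact continuous_prod.comp
      (continuous_induced_dom (f := fun x : A ⋊[conjAction e s] B => (x.left, x.right)))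

theorem semidirectProductHom_injective [IsTopologicalGroup P] {r : P →* B}
    (hr : ∀ b, r (s b) = b) (hM : M ≤ r.ker) : Function.Injective (semidirectProductHom e s) := by
  refine (injective_iff_map_eq_one _).mpr ?_
  rintro ⟨a, b⟩ (hab : (e a : P) * s b = 1)
  have hea : r (e a) = 1 := hM (e a).2
  obtain rfl : b = 1 := by simpa [hea, hr] using congrArg r hab
  rw [map_one, mul_one, OneMemClass.coe_eq_one, map_eq_one_iff e e.injective] at hab
  rw [hab]
  rfl

open scoped Pointwise in
theorem semidirectProductHom_surjective [IsTopologicalGroup P] [T2Space P] [CompactSpace A]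
    [CompactSpace B] (h : Dense ((M : Set P) * Set.range s)) :
    Function.Surjective (semidirectProductHom e s) := by
  refine surjective_of_continuous_of_denseRange (map_continuous _) (h.mono ?_)
  rintro _ ⟨m, hm, _, ⟨b, rfl⟩, rfl⟩
  exact ⟨⟨e.symm ⟨m, hm⟩, b⟩, congrArg (· * s b) (congrArg Subtype.val (e.apply_symm_apply _))⟩

end InternalSemidirectProduct

section Invariant

variable {G : Type*} [Group G] {N : Subgroup G} [N.Normal] (H : Subgroup G) (U : Subgroup N)

/-- A subgroup of the normal subgroup `N` is `H`-invariant if it is stable under conjugation by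
the elements of `H`. -/
def IsConjInvariant : Prop := ∀ h : H, ∀ x ∈ U, MulAut.conjNormal (h : G) x ∈ U

variable {H U}

theorem IsConjInvariant.le_normalizer (hU : IsConjInvariant H U) :
    H ≤ Subgroup.normalizer (U.map N.subtype) := by
  rw [Subgroup.le_normalizer_iff]
  rintro h hh _ ⟨x, hx, rfl⟩
  exact ⟨_, hU ⟨h, hh⟩ x hx, rfl⟩

end Invariant

namespace IsTopologicalSemidirectProduct

variable {G : Type*} [Group G] [TopologicalSpace G] {N H : Subgroup G}

theorem isComplement' (hNH : IsTopologicalSemidirectProduct N H) : N.IsComplement' H :=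
  hNH.isHomeomorph.bijective

/-- The retraction `n * h ↦ h` of `N ⋊ H` onto `H`. -/
noncomputable def retraction (hNH : IsTopologicalSemidirectProduct N H) : G →ₜ* H where
  toMonoidHom :=
    have := hNH.normal
    SemidirectProduct.rightHom.comp
      (SemidirectProduct.mulEquivSubgroup hNH.isComplement').symm.toMonoidHom
  continuous_toFun :=
    have := hNH.normal
    hNH.isHomeomorph.isQuotientMap.continuous_iff.mpr <| continuous_snd.congr fun p =>
      (congrArg SemidirectProduct.right ((SemidirectProduct.mulEquivSubgroup
        hNH.isComplement').symm_apply_apply ⟨p.1, p.2⟩)).symm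

theorem retraction_mul (hNH : IsTopologicalSemidirectProduct N H) (x : N) (y : H) :
    hNH.retraction (x * y) = y :=
  have := hNH.normal
  congrArg SemidirectProduct.right
    ((SemidirectProduct.mulEquivSubgroup hNH.isComplement').symm_apply_apply ⟨x, y⟩)

theorem retraction_left (hNH : IsTopologicalSemidirectProduct N H) (x : N) :
    hNH.retraction x = 1 := by
  simpa using hNH.retraction_mul x 1

theorem retraction_right (hNH : IsTopologicalSemidirectProduct N H) (y : H) :
    hNH.retraction y = y := by
  simpa using hNH.retraction_mul 1 y

variable {U : Subgroup N}

theorem finiteIndex_map_sup (hNH : IsTopologicalSemidirectProduct N H) [U.FiniteIndex] :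
    (U.map N.subtype ⊔ H).FiniteIndex := by
  let W := U.map N.subtype ⊔ H
  have hUW : U ≤ W.comap N.subtype := Subgroup.map_le_iff_le_comap.mp le_sup_left
  let f : N ⧸ U → G ⧸ W := Quotient.map' Subtype.val fun x y hxy =>
    QuotientGroup.leftRel_apply.mpr (hUW (QuotientGroup.leftRel_apply.mp hxy))
  have hf : Function.Surjective f := by
    rintro ⟨g⟩
    obtain ⟨⟨x, y⟩, rfl⟩ := hNH.isHomeomorph.surjective g
    exact ⟨x, QuotientGroup.eq.mpr (by simpa using Subgroup.mem_sup_right y.2)⟩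
  have := Finite.of_surjective f hf
  exact Subgroup.finiteIndex_of_finite_quotient

variable [N.Normal]

theorem comap_subtype_map_sup (hNH : IsTopologicalSemidirectProduct N H)
    (hU : IsConjInvariant H U) : (U.map N.subtype ⊔ H).comap N.subtype = U := by
  refine le_antisymm (fun x hx => ?_) (Subgroup.map_le_iff_le_comap.mp le_sup_left)
  obtain ⟨_, ⟨u, hu, rfl⟩, h, hh, hxu⟩ :=
    (Subgroup.coe_mul_of_right_le_normalizer_left _ _ hU.le_normalizer).le hx
  obtain ⟨rfl, -⟩ := Prod.ext_iff.mp (hNH.isHomeomorph.injective (a₁ := (u, ⟨h, hh⟩))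
    (a₂ := (x, 1)) (hxu.trans (mul_one _).symm))
  exact hu

theorem isOpen_map_sup (hNH : IsTopologicalSemidirectProduct N H) (hU : IsConjInvariant H U)
    (hUo : IsOpen (U : Set N)) : IsOpen ((U.map N.subtype ⊔ H : Subgroup G) : Set G) := by
  convert hNH.isHomeomorph.isOpenMap _ (hUo.prod isOpen_univ)
  ext g
  rw [Subgroup.coe_mul_of_right_le_normalizer_left _ _ hU.le_normalizer]
  simp [Set.mem_mul]

theorem exists_openNormal_comap_le [IsTopologicalGroup G] [U.FiniteIndex]
    (hNH : IsTopologicalSemidirectProduct N H) (hU : IsConjInvariant H U)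
    (hUo : IsOpen (U : Set N)) :
    ∃ W : Subgroup G, W.Normal ∧ W.FiniteIndex ∧ IsOpen (W : Set G) ∧ W.comap N.subtype ≤ U := by
  let W := U.map N.subtype ⊔ H
  have : W.FiniteIndex := hNH.finiteIndex_map_sup
  have hW : IsClosed (W : Set G) := Subgroup.isClosed_of_isOpen _ (hNH.isOpen_map_sup hU hUo)
  exact ⟨W.normalCore, inferInstance, inferInstance,
    Subgroup.isOpen_of_isClosed_of_finiteIndex _ (Subgroup.normalCore_isClosed _ hW),
    (Subgroup.comap_mono W.normalCore_le).trans_eq (hNH.comap_subtype_map_sup hU)⟩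

end IsTopologicalSemidirectProduct

section Semisimple

open scoped MonoidAlgebra

theorem exists_isSimpleModule_smul_ne_zero {R M : Type*} [Ring R] [AddCommGroup M] [Module R M]
    [IsSemisimpleModule R M] {r : R} {x : M} (hx : r • x ≠ 0) :
    ∃ m : Submodule R M, IsSimpleModule R m ∧ ∃ y ∈ m, r • y ≠ 0 := by
  by_contra! h
  have hx_mem : x ∈ ⨆ m : {m : Submodule R M | IsSimpleModule R m}, (m : Submodule R M) := by
    rw [← sSup_eq_iSup', IsSemisimpleModule.sSup_simples_eq_top]
    trivial
  refine hx (Submodule.iSup_induction _ (motive := fun y => r • y = 0) hx_mem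
    (fun m y hy => h m m.2 y hy) (smul_zero r) fun y z hy hz => ?_)
  rw [smul_add, hy, hz, add_zero]

variable {k G V W : Type*} [Field k] [Monoid G] [AddCommGroup V] [Module k V]
  [AddCommGroup W] [Module k W]

theorem isIrreducible_of_injective_of_isAtom_range {σ : Representation k G V}
    {ρ : Representation k G W} (f : σ.IntertwiningMap ρ) (hf : Function.Injective f)
    (hrange : IsAtom f.range) : σ.IsIrreducible := by
  let f' : σ.asModule →ₗ[k[G]] ρ.asModule :=
    Representation.IntertwiningMap.equivLinearMapAsModule σ ρ f
  have hsimple : IsSimpleModule k[G] (LinearMap.range f') :=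
    isSimpleModule_iff_isAtom.mpr
      ((Subrepresentation.subrepresentationSubmoduleOrderIso.isAtom_iff _).mpr hrange)
  exact (Representation.irreducible_iff_isSimpleModule_asModule σ).mpr
    (IsSimpleModule.congr (LinearEquiv.ofInjective f' hf))

theorem exists_isAtom_apply_ne (ρ : Representation k G V) [ρ.IsSemisimpleRepresentation] {a : G}
    (ha : ρ a ≠ 1) : ∃ W : Subrepresentation ρ, IsAtom W ∧ ∃ w ∈ W, ρ a w ≠ w := by
  have : IsSemisimpleModule k[G] ρ.asModule :=
    (Representation.isSemisimpleRepresentation_iff_isSemisimpleModule_asModule ρ).mp inferInstance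
  have smul_eq (v : V) : (MonoidAlgebra.single a (1 : k) - 1 : k[G]) • (show ρ.asModule from v) =
      (ρ a v - v : V) := by
    rw [sub_smul, one_smul, Representation.single_smul, one_smul]
    rfl
  obtain ⟨v, hv⟩ : ∃ v, ρ a v ≠ v := by
    by_contra! h
    exact ha (LinearMap.ext h)
  obtain ⟨m, hm, w, hwm, hw⟩ := exists_isSimpleModule_smul_ne_zero (R := k[G]) (M := ρ.asModule)
    (x := v) ((smul_eq v).trans_ne (sub_ne_zero.mpr hv))
  exact ⟨Subrepresentation.ofSubmodule' m,
    (Subrepresentation.subrepresentationSubmoduleOrderIso.symm.isAtom_iff m).mpr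
      (isSimpleModule_iff_isAtom.mp hm),
    w, hwm, sub_ne_zero.mp ((smul_eq w).symm.trans_ne hw)⟩

end Semisimple

section Unitary

open scoped InnerProductSpace

/-- A representation on an inner product space is unitary when every operator preserves inner
products. -/
def PreservesInner {𝕜 F E : Type*} [RCLike 𝕜] [Monoid F] [NormedAddCommGroup E]
    [InnerProductSpace 𝕜 E] (ρ : Representation 𝕜 F E) : Prop :=
  ∀ g v w, ⟪ρ g v, ρ g w⟫_𝕜 = ⟪v, w⟫_𝕜

variable {𝕜 F E : Type*} [RCLike 𝕜] [Group F] [NormedAddCommGroup E] [InnerProductSpace 𝕜 E]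
  {ρ : Representation 𝕜 F E}

theorem PreservesInner.toRepresentation (hρ : PreservesInner ρ) (W : Subrepresentation ρ) :
    PreservesInner W.toRepresentation :=
  fun g v w => hρ g v w

variable [FiniteDimensional 𝕜 E]

theorem PreservesInner.isSemisimpleRepresentation
    (hρ : PreservesInner ρ) : ρ.IsSemisimpleRepresentation where
  exists_isCompl W := by
    let W' : Subrepresentation ρ :=
      { toSubmodule := W.toSubmoduleᗮ
        apply_mem_toSubmodule := fun g v hv w hw => by
          rw [← hρ g⁻¹, Representation.inv_self_apply]
          exact hv _ (W.apply_mem_toSubmodule g⁻¹ hw) }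
    have hW : IsCompl W.toSubmodule W'.toSubmodule :=
      Submodule.isCompl_orthogonal _
    exact ⟨W', IsCompl.of_eq (Subrepresentation.toSubmodule_injective hW.inf_eq_bot)
      (Subrepresentation.toSubmodule_injective hW.sup_eq_top)⟩

theorem PreservesInner.toMatrixOrthonormal_mem_unitaryGroup {ι : Type*} [Fintype ι]
    [DecidableEq ι] (hρ : PreservesInner ρ) (b : OrthonormalBasis ι 𝕜 E) (g : F) :
    LinearMap.toMatrixOrthonormal b (ρ g) ∈ Matrix.unitaryGroup ι 𝕜 := by
  have star_mul : star (ρ g) * ρ g = 1 := by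
    refine LinearMap.ext fun v => ext_inner_left 𝕜 fun w => ?_
    rw [Module.End.mul_apply, LinearMap.star_eq_adjoint, LinearMap.adjoint_inner_right]
    exact hρ g w v
  rw [Matrix.mem_unitaryGroup_iff', ← map_star, ← map_mul, star_mul, map_one]

/-- The matrix form of a unitary representation in an orthonormal basis. -/
noncomputable def PreservesInner.toUnitaryGroup {ι : Type*} [Fintype ι] [DecidableEq ι]
    (hρ : PreservesInner ρ) (b : OrthonormalBasis ι 𝕜 E) : F →* Matrix.unitaryGroup ι 𝕜 :=
  MonoidHom.codRestrict ((MonoidHomClass.toMonoidHom (LinearMap.toMatrixOrthonormal b)).comp ρ)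
    (Matrix.unitaryGroup ι 𝕜) (hρ.toMatrixOrthonormal_mem_unitaryGroup b)

theorem PreservesInner.ker_toUnitaryGroup {ι : Type*} [Fintype ι] [DecidableEq ι]
    (hρ : PreservesInner ρ) (b : OrthonormalBasis ι 𝕜 E) :
    (hρ.toUnitaryGroup b).ker = MonoidHom.ker ρ := by
  ext g
  rw [MonoidHom.mem_ker, MonoidHom.mem_ker, Subtype.ext_iff]
  exact map_eq_one_iff _ (LinearMap.toMatrixOrthonormal b).injective

end Unitary

theorem continuous_of_isOpen_ker {F M : Type*} [Group F] [TopologicalSpace F]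
    [IsTopologicalGroup F] [Group M] [TopologicalSpace M] [IsTopologicalGroup M] (f : F →* M)
    (hf : IsOpen (f.ker : Set F)) : Continuous f :=
  continuous_of_continuousAt_one f <| continuousAt_const.congr <| by
    filter_upwards [hf.mem_nhds (one_mem f.ker)] with g hg using hg.symm

namespace UnitaryRep

variable {F : Type u} [Group F] [TopologicalSpace F] [IsTopologicalGroup F] {E : Type*}
  [NormedAddCommGroup E] [InnerProductSpace ℂ E] [FiniteDimensional ℂ E]
  {ρ : Representation ℂ F E}

/-- The unitary representation on `ℂⁿ` given by `ρ` in an orthonormal basis. -/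
noncomputable def ofOrthonormalBasis {n : ℕ} (b : OrthonormalBasis (Fin n) ℂ E)
    (hρ : PreservesInner ρ) (hker : IsOpen (MonoidHom.ker ρ : Set F)) : UnitaryRep F n where
  toMonoidHom := hρ.toUnitaryGroup b
  continuous_toFun := continuous_of_isOpen_ker _ (hρ.ker_toUnitaryGroup b ▸ hker)

/-- The coordinate isomorphism of the matrix form of `ρ` with `ρ`. -/
noncomputable def ofOrthonormalBasisEquiv {n : ℕ} (b : OrthonormalBasis (Fin n) ℂ E)
    (hρ : PreservesInner ρ) (hker : IsOpen (MonoidHom.ker ρ : Set F)) :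
    (ofOrthonormalBasis b hρ hker).toRepresentation.Equiv ρ :=
  .mk b.toBasis.equivFun.symm fun g => LinearMap.ext fun v => by
    have mulVec_repr := LinearMap.toMatrix_mulVec_repr b.toBasis b.toBasis (ρ g)
      (b.toBasis.equivFun.symm v)
    rw [← Module.Basis.equivFun_apply, LinearEquiv.apply_symm_apply] at mulVec_repr
    have apply_eq : (ofOrthonormalBasis b hρ hker).toRepresentation g v =
      (LinearMap.toMatrix b.toBasis b.toBasis (ρ g)).mulVec v := rfl
    exact (LinearEquiv.symm_apply_eq _).mpr (apply_eq.trans mulVec_repr)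

theorem exists_irreducible (hρ : PreservesInner ρ) (hker : IsOpen (MonoidHom.ker ρ : Set F))
    {a : F} (ha : ρ a ≠ 1) :
    ∃ (n : ℕ) (σ : UnitaryRep F n), σ.toRepresentation.IsIrreducible ∧ σ a ≠ 1 ∧
      MonoidHom.ker ρ ≤ σ.toMonoidHom.ker := by
  have := hρ.isSemisimpleRepresentation
  obtain ⟨W, hW, w, hwW, hw⟩ := exists_isAtom_apply_ne ρ ha
  have hle : MonoidHom.ker ρ ≤ MonoidHom.ker W.toRepresentation := fun g (hg : ρ g = 1) =>
    LinearMap.ext fun v => Subtype.ext (LinearMap.congr_fun hg v)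
  let b := stdOrthonormalBasis ℂ W.toSubmodule
  have hσker := (hρ.toRepresentation W).ker_toUnitaryGroup b
  let σ := ofOrthonormalBasis b (hρ.toRepresentation W) (Subgroup.isOpen_mono hle hker)
  let incl : W.toRepresentation.IntertwiningMap ρ := ⟨W.toSubmodule.subtype, fun _ => rfl⟩
  let e := ofOrthonormalBasisEquiv b (hρ.toRepresentation W) (Subgroup.isOpen_mono hle hker)
  have hrange : (incl.comp e.toIntertwiningMap).range = W := by
    ext v
    exact ⟨fun ⟨u, hu⟩ => hu ▸ (e u).2, fun hv =>
      (e.toLinearEquiv.surjective ⟨v, hv⟩).imp fun _ hu => congrArg Subtype.val hu⟩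
  refine ⟨_, σ, isIrreducible_of_injective_of_isAtom_range (incl.comp e.toIntertwiningMap)
    (Subtype.val_injective.comp e.toLinearEquiv.injective) (hrange.symm ▸ hW), fun h => hw ?_,
    hle.trans_eq hσker.symm⟩
  have : W.toRepresentation a = 1 := hσker.le h
  exact congrArg Subtype.val (LinearMap.congr_fun this ⟨w, hwW⟩)

end UnitaryRep

section Permutation

/-- The permutation representation on the Hilbert space `ℓ²(X)`. -/
noncomputable def permutationRep (𝕜 F X : Type*) [RCLike 𝕜] [Group F] [Fintype X] [MulAction F X] :
    Representation 𝕜 F (EuclideanSpace 𝕜 X) where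
  toFun g := (LinearIsometryEquiv.piLpCongrLeft 2 𝕜 𝕜 (MulAction.toPerm g)).toLinearMap
  map_one' := by
    ext v x
    simp [LinearIsometryEquiv.piLpCongrLeft_apply, Equiv.piCongrLeft'_apply]
  map_mul' g h := by
    ext v x
    simp [LinearIsometryEquiv.piLpCongrLeft_apply, Equiv.piCongrLeft'_apply, mul_smul]

variable {𝕜 F X : Type*} [RCLike 𝕜] [Group F] [Fintype X] [MulAction F X]

theorem permutationRep_apply (g : F) (v : EuclideanSpace 𝕜 X) (x : X) :
    permutationRep 𝕜 F X g v x = v (g⁻¹ • x) := rfl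

theorem preservesInner_permutationRep : PreservesInner (permutationRep 𝕜 F X) := fun g v w =>
  (LinearIsometryEquiv.piLpCongrLeft 2 𝕜 𝕜 (MulAction.toPerm (β := X) g)).inner_map_map v w

theorem ker_permutationRep :
    MonoidHom.ker (permutationRep 𝕜 F X) = (MulAction.toPermHom F X).ker := by
  classical
  ext g
  refine ⟨fun hg => ?_, fun hg => ?_⟩
  · have hg' : permutationRep 𝕜 F X g⁻¹ = 1 := inv_mem hg
    refine Equiv.ext fun x => ?_
    have apply_eq := congrArg (· x) (LinearMap.congr_fun hg' (EuclideanSpace.single x (1 : 𝕜)))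
    have smul_eq : g • x = x := by simpa [permutationRep_apply] using apply_eq
    exact smul_eq
  · have hg' : MulAction.toPermHom F X g⁻¹ = 1 := inv_mem hg
    ext v x
    exact congrArg v (Equiv.congr_fun hg' x)

end Permutation

theorem UnitaryRep.exists_irreducible_of_notMem {F : Type u} [Group F] [TopologicalSpace F]
    [IsTopologicalGroup F] {U : Subgroup F} [U.Normal] [U.FiniteIndex] (hU : IsOpen (U : Set F))
    {a : F} (ha : a ∉ U) :
    ∃ (n : ℕ) (σ : UnitaryRep F n), σ.toRepresentation.IsIrreducible ∧ σ a ≠ 1 ∧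
      U ≤ σ.toMonoidHom.ker := by
  have := Fintype.ofFinite (F ⧸ U)
  have hker : MonoidHom.ker (permutationRep ℂ F (F ⧸ U)) = U := by
    rw [ker_permutationRep, ← Subgroup.normalCore_eq_ker, Subgroup.normalCore_eq_self]
  obtain ⟨n, σ, hirr, hσa, hσ⟩ :=
    exists_irreducible (preservesInner_permutationRep (𝕜 := ℂ) (F := F) (X := F ⧸ U))
      (hker.symm ▸ hU) (a := a) fun h => ha (hker.le h)
  exact ⟨n, σ, hirr, hσa, hker.ge.trans hσ⟩

theorem finite_setOf_eq_one_and_mem {F A M : Type*} [Group A] [Monoid M] [FunLike F A M]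
    [MonoidHomClass F A M] (U : Subgroup A) [U.FiniteIndex] {S : Set M} (hS : S.Finite) :
    {f : F | (∀ u ∈ U, f u = 1) ∧ ∀ a, f a ∈ S}.Finite := by
  have apply_out {f : F} (hf : ∀ u ∈ U, f u = 1) (a : A) : f (a : A ⧸ U).out = f a := by
    obtain ⟨u, hu⟩ := QuotientGroup.mk_out_eq_mul U a
    rw [hu, map_mul, hf u u.2, mul_one]
  refine Set.Finite.of_injOn (f := fun f (q : A ⧸ U) => f q.out)
    (t := {g | ∀ q, g q ∈ S}) (fun f hf q => hf.2 _) (fun f hf f' hf' h => ?_)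
    (Set.Finite.pi' fun _ => hS)
  exact DFunLike.ext _ _ fun a =>
    (apply_out hf.1 a).symm.trans ((congrFun h (a : A ⧸ U)).trans (apply_out hf'.1 a))

theorem UnitaryRep.ker_eq_of_equiv {N : Type u} [Group N] [TopologicalSpace N] {n : ℕ}
    {σ τ : UnitaryRep N n} (h : UnitaryRep.setoid N n σ τ) :
    σ.toMonoidHom.ker = τ.toMonoidHom.ker := by
  obtain ⟨u, hu⟩ := h
  ext x
  change σ x = 1 ↔ τ x = 1
  rw [← hu, conj_eq_one_iff]

namespace FinitePeriodicIrrep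

variable {G : Type u} [Group G] [TopologicalSpace G] [IsTopologicalGroup G] {N H : Subgroup G}
  [N.Normal]

/-- An irreducible unitary representation trivial on an `H`-invariant subgroup of finite index,
regarded as a representation with finite image and finite `H`-orbit. -/
def ofFiniteIndex {U : Subgroup N} [U.FiniteIndex] (hU : IsConjInvariant H U) {n : ℕ}
    (σ : UnitaryRep N n) (hirr : σ.toRepresentation.IsIrreducible) (hσ : U ≤ σ.toMonoidHom.ker) :
    FinitePeriodicIrrep N H :=
  have := Subgroup.finiteIndex_of_le hσ
  have finite_range : (Set.range σ).Finite :=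
    (Set.finite_range (QuotientGroup.kerLift σ.toMonoidHom)).subset <| by
      rintro _ ⟨x, rfl⟩
      exact ⟨x, rfl⟩
  { dim := n
    rep := σ
    irreducible := hirr
    finite_image := finite_range
    finite_orbit := by
      refine ((finite_setOf_eq_one_and_mem (F := UnitaryRep N n) U finite_range).image
        (Quotient.mk (UnitaryRep.setoid N n))).subset ?_
      rintro _ ⟨h, rfl⟩
      exact ⟨σ.conj (h : G), ⟨fun u hu => hσ (hU h⁻¹ u hu), fun x => ⟨_, rfl⟩⟩, rfl⟩ }

variable (σ : FinitePeriodicIrrep N H)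

/-- The common kernel of the conjugates of `σ` under `H`. -/
noncomputable def orbitKernel : Subgroup N :=
  ⨅ h : H, (σ.rep.conj (h : G)).toMonoidHom.ker

theorem orbitKernel_le_ker : σ.orbitKernel ≤ σ.rep.toMonoidHom.ker := fun x hx => by
  have conj_one_apply : σ.rep (MulAut.conjNormal (1 : G)⁻¹ x) = 1 := Subgroup.mem_iInf.mp hx 1
  rwa [inv_one, map_one] at conj_one_apply

theorem isConjInvariant_orbitKernel : IsConjInvariant H σ.orbitKernel := fun h x hx => by
  refine Subgroup.mem_iInf.mpr fun k => ?_
  have conj_apply : σ.rep (MulAut.conjNormal ((h⁻¹ * k : H) : G)⁻¹ x) = 1 :=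
    Subgroup.mem_iInf.mp hx (h⁻¹ * k)
  change σ.rep (MulAut.conjNormal (k : G)⁻¹ (MulAut.conjNormal (h : G) x)) = 1
  rwa [← MulAut.mul_apply, ← map_mul, ← inv_inv (h : G), ← mul_inv_rev]

theorem finite_range_ker_conj :
    (Set.range fun h : H => (σ.rep.conj (h : G)).toMonoidHom.ker).Finite := by
  refine (σ.finite_orbit.image (Quotient.lift (fun τ => τ.toMonoidHom.ker)
    fun _ _ => UnitaryRep.ker_eq_of_equiv)).subset ?_
  rintro _ ⟨h, rfl⟩
  exact ⟨_, ⟨h, rfl⟩, rfl⟩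

theorem finiteIndex_ker_conj (g : G) : (σ.rep.conj g).toMonoidHom.ker.FiniteIndex := by
  have : Finite (σ.rep.conj g).toMonoidHom.range :=
    (σ.finite_image.subset (Set.range_comp_subset_range (conjHom N g⁻¹) σ.rep)).to_subtype
  exact Subgroup.finiteIndex_ker _

instance finiteIndex_orbitKernel : σ.orbitKernel.FiniteIndex := by
  have := σ.finite_range_ker_conj.to_subtype
  rw [orbitKernel, ← sInf_range, sInf_eq_iInf']
  exact Subgroup.finiteIndex_iInf fun ⟨_, h, hh⟩ => hh ▸ σ.finiteIndex_ker_conj (h : G)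

theorem isOpen_orbitKernel : IsOpen (σ.orbitKernel : Set N) := by
  refine Subgroup.isOpen_of_isClosed_of_finiteIndex _ ?_
  rw [orbitKernel, Subgroup.coe_iInf]
  exact isClosed_iInter fun h =>
    isClosed_singleton.preimage (map_continuous (σ.rep.conj (h : G)))

end FinitePeriodicIrrep

section Closure

variable {G : Type u} [Group G] [TopologicalSpace G] {PG : Type u} [Group PG]
  [TopologicalSpace PG] [IsProfiniteGroup PG]

theorem closureImage_normal {α : G →ₜ* PG} (hα : DenseRange α) (N : Subgroup G) [hN : N.Normal] :
    (closureImage α N).Normal := by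
  have hclosed : IsClosed (closureImage α N : Set PG) := Subgroup.isClosed_topologicalClosure _
  have conj_apply_mem {x : G} (hx : x ∈ N) (p : PG) : p * α x * p⁻¹ ∈ closureImage α N :=
    hα.induction_on (p := fun p => p * α x * p⁻¹ ∈ closureImage α N) p
      (hclosed.preimage (f := fun p => p * α x * p⁻¹) (by fun_prop)) fun g =>
      Subgroup.le_topologicalClosure _ ⟨g * x * g⁻¹, hN.conj_mem x hx g, by simp⟩
  refine ⟨fun m hm p => ?_⟩
  refine closure_minimal (t := {m | p * m * p⁻¹ ∈ closureImage α N}) ?_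
    (hclosed.preimage (f := fun m => p * m * p⁻¹) (by fun_prop)) hm
  rintro _ ⟨x, hx, rfl⟩
  exact conj_apply_mem hx p

variable {S : Subgroup G} {PS : Type u} [Group PS] [TopologicalSpace PS] {αS : S →ₜ* PS}

/-- The map `ψ_S` as a homomorphism `Prof(S) → Prof(G)`. -/
noncomputable def psiVal (hS : IsProfiniteCompletion αS) (α : G →ₜ* PG) : PS →ₜ* PG where
  toMonoidHom := (closureImage α S).subtype.comp (psi hS α).toMonoidHom
  continuous_toFun := continuous_subtype_val.comp (map_continuous (psi hS α))

variable [IsTopologicalGroup G]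

theorem psiVal_apply (hS : IsProfiniteCompletion αS) (α : G →ₜ* PG) (s : S) :
    psiVal hS α (αS s) = α s :=
  psi_apply hS α s

theorem psi_surjective (hS : IsProfiniteCompletion αS) (α : G →ₜ* PG) :
    Function.Surjective (psi hS α) := by
  have := hS.profinite
  refine surjective_of_continuous_of_denseRange (map_continuous _) fun ⟨z, hz⟩ => ?_
  refine closure_subtype.mpr (closure_mono ?_ hz)
  rintro _ ⟨s, hs, rfl⟩
  exact ⟨psi hS α (αS ⟨s, hs⟩), ⟨_, rfl⟩, psi_apply hS α ⟨s, hs⟩⟩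

theorem psiVal_profConj {N : Subgroup G} [N.Normal] {PN : Type u} [Group PN] [TopologicalSpace PN]
    [IsProfiniteGroup PN] {αN : N →ₜ* PN} (hN : IsProfiniteCompletion αN) (α : G →ₜ* PG)
    (g : G) (p : PN) : psiVal hN α (profConj hN g p) = α g * psiVal hN α p * (α g)⁻¹ := by
  refine congrFun (hN.denseRange.equalizer (g := fun p => psiVal hN α (profConj hN g p))
    (h := fun p => α g * psiVal hN α p * (α g)⁻¹) (by fun_prop) (by fun_prop)
    (funext fun x => ?_)) p
  simp only [Function.comp_apply, profConj_apply, psiVal_apply, conjHom_apply, map_mul, map_inv]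

end Closure

section NormalFactor

variable {G : Type u} [Group G] [TopologicalSpace G] [IsTopologicalGroup G] {N H : Subgroup G}
  [N.Normal] {PG PN : Type u} [Group PG] [TopologicalSpace PG] [IsProfiniteGroup PG] [Group PN]
  [TopologicalSpace PN] {αG : G →ₜ* PG} {αN : N →ₜ* PN}

theorem periodicKernel_le (hN : IsProfiniteCompletion αN) {V : Subgroup PN} [V.Normal]
    (hVo : IsOpen (V : Set PN)) (hV : IsConjInvariant H (V.comap αN.toMonoidHom)) :
    periodicKernel H hN ≤ V := by
  have := hN.profinite
  have := Subgroup.quotient_finite_of_isOpen V hVo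
  have : V.FiniteIndex := Subgroup.finiteIndex_of_finite_quotient
  let U := V.comap αN.toMonoidHom
  have : U.FiniteIndex := ⟨by
    rw [Subgroup.index_comap]
    exact (Subgroup.FiniteIndex.index_ne_zero (H := V.subgroupOf αN.toMonoidHom.range))⟩
  intro p hp
  by_contra hpV
  -- A representation trivial on `V` takes the same value at `p` and at `αN x`.
  obtain ⟨x, hx⟩ : ∃ x, p⁻¹ * αN x ∈ V :=
    hN.denseRange.exists_mem_open (hVo.preimage (continuous_const_mul p⁻¹)) ⟨p, by simp⟩
  have hxU : x ∉ U := fun h : αN x ∈ V => hpV (inv_mem_iff.mp ((mul_mem_cancel_right h).mp hx))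
  obtain ⟨n, σ, hirr, hσx, hσU⟩ :=
    UnitaryRep.exists_irreducible_of_notMem (hVo.preimage (map_continuous αN)) hxU
  let τ := FinitePeriodicIrrep.ofFiniteIndex hV σ hirr hσU
  let ρ := UnitaryRep.prof hN τ.rep τ.finite_image
  have hρ (z : N) : ρ (αN z) = σ z := UnitaryRep.prof_apply hN _ _ z
  have V_le_ker : V ≤ ρ.toMonoidHom.ker :=
    subset_of_preimage_subset_of_denseRange hN.denseRange hVo
      (isClosed_singleton.preimage (map_continuous ρ)) fun z hz => (hρ z).trans (hσU hz)
  have hp' : ρ p = 1 := Subgroup.mem_iInf.mp hp τ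
  have hx' : ρ (p⁻¹ * αN x) = 1 := V_le_ker hx
  rw [map_mul, map_inv, hp', inv_one, one_mul, hρ] at hx'
  exact hσx hx'

theorem periodicKernel_le_ker_psi (hN : IsProfiniteCompletion αN) :
    periodicKernel H hN ≤ (psi hN αG).toMonoidHom.ker := fun p hp =>
  Subtype.ext <| eq_one_of_forall_mem_openNormalSubgroup fun W => by
    let V := W.toSubgroup.comap (psiVal hN αG).toMonoidHom
    have mem_iff (x : N) : αN x ∈ V ↔ αG x ∈ W := by
      change psiVal hN αG (αN x) ∈ W ↔ αG x ∈ W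
      rw [psiVal_apply]
    refine periodicKernel_le hN (V := V) (W.isOpen'.preimage (map_continuous (psiVal hN αG)))
      (fun h x hx => (mem_iff _).mpr ?_) hp
    rw [MulAut.conjNormal_apply, map_mul, map_mul, map_inv]
    exact W.isNormal'.conj_mem _ ((mem_iff x).mp hx) _

theorem ker_psi_le_periodicKernel (hNH : IsTopologicalSemidirectProduct N H)
    (hG : IsProfiniteCompletion αG) (hN : IsProfiniteCompletion αN) :
    (psi hN αG).toMonoidHom.ker ≤ periodicKernel H hN := fun p hp =>
  Subgroup.mem_iInf.mpr fun σ => by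
    obtain ⟨W, hWn, hWf, hWo, hW⟩ := hNH.exists_openNormal_comap_le
      σ.isConjInvariant_orbitKernel σ.isOpen_orbitKernel
    have := QuotientGroup.discreteTopology hWo
    have : IsProfiniteGroup (G ⧸ W) := { }
    let mkW : G →ₜ* (G ⧸ W) := ⟨QuotientGroup.mk' W, continuous_quotient_mk'⟩
    let f : PN →ₜ* (G ⧸ W) := (hG.lift mkW).comp (psiVal hN αG)
    have hfp : f p = 1 := by
      rw [ContinuousMonoidHom.coe_comp, Function.comp_apply, show psiVal hN αG p = 1 from
        congrArg Subtype.val hp, map_one]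
    have hf (x : N) : f (αN x) = ((x : G) : G ⧸ W) := by
      rw [ContinuousMonoidHom.coe_comp, Function.comp_apply, psiVal_apply, hG.lift_apply]
      rfl
    refine subset_of_preimage_subset_of_denseRange hN.denseRange (V := f ⁻¹' {1})
      ((isOpen_discrete {1}).preimage (map_continuous f))
      (isClosed_singleton.preimage (map_continuous (UnitaryRep.prof hN σ.rep σ.finite_image)))
      (fun x hx => ?_) hfp
    have hxW : (x : G) ∈ W := (QuotientGroup.eq_one_iff _).mp ((hf x).symm.trans hx)
    exact (UnitaryRep.prof_apply hN _ _ x).trans (σ.orbitKernel_le_ker (hW hxW))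

theorem ker_psi_eq_periodicKernel (hNH : IsTopologicalSemidirectProduct N H)
    (hG : IsProfiniteCompletion αG) (hN : IsProfiniteCompletion αN) :
    (psi hN αG).toMonoidHom.ker = periodicKernel H hN :=
  (ker_psi_le_periodicKernel hNH hG hN).antisymm (periodicKernel_le_ker_psi hN)

/-- The isomorphism of `Prof(N) / D` with the closure of `α_G(N)` induced by `ψ_N`. -/
noncomputable def quotientPeriodicKernelEquiv (hNH : IsTopologicalSemidirectProduct N H)
    (hG : IsProfiniteCompletion αG) (hN : IsProfiniteCompletion αN) :
    (PN ⧸ periodicKernel H hN) ≃ₜ* closureImage αG N :=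
  have := hN.profinite
  have hker := ker_psi_eq_periodicKernel hNH hG hN
  continuousMulEquivOfBijective
    ⟨QuotientGroup.lift _ (psi hN αG).toMonoidHom hker.ge,
      (map_continuous (psi hN αG)).quotient_lift _⟩
    ⟨(QuotientGroup.injective_lift_iff _ _ hker.ge).mpr hker.symm,
      QuotientGroup.lift_surjective_of_surjective _ _ (psi_surjective hN αG) hker.ge⟩

theorem map_profAction_periodicKernel [IsProfiniteGroup PN]
    (hNH : IsTopologicalSemidirectProduct N H) (hG : IsProfiniteCompletion αG)
    (hN : IsProfiniteCompletion αN) (h : H) :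
    (periodicKernel H hN).map (profAction H hN h).toMonoidHom = periodicKernel H hN := by
  have map_le (h : H) :
      (periodicKernel H hN).map (profAction H hN h).toMonoidHom ≤ periodicKernel H hN := by
    rintro _ ⟨x, hx, rfl⟩
    rw [SetLike.mem_coe, ← ker_psi_eq_periodicKernel hNH hG hN] at hx
    rw [← ker_psi_eq_periodicKernel hNH hG hN]
    have psiVal_eq_one : psiVal hN αG x = 1 := congrArg Subtype.val hx
    refine Subtype.ext ((psiVal_profConj hN αG (h : G) x).trans ?_)
    rw [psiVal_eq_one, mul_one, mul_inv_cancel, OneMemClass.coe_one]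
  refine (map_le h).antisymm fun y hy => ⟨profAction H hN h⁻¹ y, map_le h⁻¹ ⟨y, hy, rfl⟩, ?_⟩
  rw [map_inv]
  exact MulEquiv.apply_symm_apply _ y

end NormalFactor

section Complement

variable {G : Type u} [Group G] [TopologicalSpace G] {N H : Subgroup G} {PG PH : Type u} [Group PG]
  [TopologicalSpace PG] [Group PH] [TopologicalSpace PH] [IsProfiniteGroup PH] {αG : G →ₜ* PG}

/-- The retraction `Prof(G) → Prof(H)` induced by the retraction of `N ⋊ H` onto `H`. -/
noncomputable def profRetraction (hNH : IsTopologicalSemidirectProduct N H)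
    (hG : IsProfiniteCompletion αG) (αH : H →ₜ* PH) : PG →ₜ* PH :=
  hG.lift (αH.comp hNH.retraction)

theorem profRetraction_apply (hNH : IsTopologicalSemidirectProduct N H)
    (hG : IsProfiniteCompletion αG) (αH : H →ₜ* PH) (g : G) :
    profRetraction hNH hG αH (αG g) = αH (hNH.retraction g) :=
  hG.lift_apply _ g

variable [IsProfiniteGroup PG]

theorem closureImage_le_ker_profRetraction (hNH : IsTopologicalSemidirectProduct N H)
    (hG : IsProfiniteCompletion αG) (αH : H →ₜ* PH) :
    closureImage αG N ≤ (profRetraction hNH hG αH).toMonoidHom.ker := by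
  refine Subgroup.topologicalClosure_minimal _ ?_
    (isClosed_singleton.preimage (map_continuous (profRetraction hNH hG αH)))
  rintro _ ⟨x, hx, rfl⟩
  exact (profRetraction_apply hNH hG αH x).trans
    ((congrArg αH (hNH.retraction_left ⟨x, hx⟩)).trans (map_one αH))

variable [IsTopologicalGroup G] {αH : H →ₜ* PH}

theorem profRetraction_psiVal (hNH : IsTopologicalSemidirectProduct N H)
    (hG : IsProfiniteCompletion αG) (hH : IsProfiniteCompletion αH) (y : PH) :
    profRetraction hNH hG αH (psiVal hH αG y) = y := by
  have comp_eq_id : (profRetraction hNH hG αH).comp (psiVal hH αG) = ContinuousMonoidHom.id PH :=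
    hH.hom_ext fun h => by
      rw [ContinuousMonoidHom.coe_comp, Function.comp_apply, psiVal_apply, profRetraction_apply,
        hNH.retraction_right]
      rfl
  exact DFunLike.congr_fun comp_eq_id y

/-- The map `ψ_H` as an isomorphism of topological groups. -/
noncomputable def psiEquiv (hNH : IsTopologicalSemidirectProduct N H)
    (hG : IsProfiniteCompletion αG) (hH : IsProfiniteCompletion αH) :
    PH ≃ₜ* closureImage αG H :=
  have leftInverse : Function.LeftInverse (profRetraction hNH hG αH ∘ Subtype.val) (psi hH αG) :=
    profRetraction_psiVal hNH hG hH
  continuousMulEquivOfBijective (psi hH αG) ⟨leftInverse.injective, psi_surjective hH αG⟩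

end Complement

section SemidirectProduct

variable {G : Type u} [Group G] [TopologicalSpace G] [IsTopologicalGroup G] {N H : Subgroup G}
  {PG PN PH : Type u} [Group PG] [TopologicalSpace PG] [IsProfiniteGroup PG] [Group PN]
  [TopologicalSpace PN] [Group PH] [TopologicalSpace PH] {αG : G →ₜ* PG} {αN : N →ₜ* PN}
  {αH : H →ₜ* PH}

open scoped Pointwise in
theorem dense_closureImage_mul_range_psiVal (hNH : IsTopologicalSemidirectProduct N H)
    (hG : DenseRange αG) (hH : IsProfiniteCompletion αH) :
    Dense ((closureImage αG N : Set PG) * Set.range (psiVal hH αG)) := by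
  refine Dense.mono ?_ hG
  rintro _ ⟨g, rfl⟩
  obtain ⟨⟨x, y⟩, rfl⟩ := hNH.isHomeomorph.surjective g
  rw [map_mul, ← psiVal_apply hH αG y]
  exact Set.mul_mem_mul (Subgroup.le_topologicalClosure _ ⟨x, x.2, rfl⟩) ⟨αH y, rfl⟩

theorem conjAction_apply_mk [N.Normal] [IsProfiniteGroup PN] [(closureImage αG N).Normal]
    (hNH : IsTopologicalSemidirectProduct N H) (hG : IsProfiniteCompletion αG)
    (hN : IsProfiniteCompletion αN) (hH : IsProfiniteCompletion αH) (h : H) (x : PN) :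
    conjAction (quotientPeriodicKernelEquiv hNH hG hN) (psiVal hH αG) (αH h) x =
      (profAction H hN h x : PN ⧸ periodicKernel H hN) := by
  refine (quotientPeriodicKernelEquiv hNH hG hN).injective (Subtype.ext ?_)
  rw [coe_conjAction_apply, psiVal_apply]
  exact (psiVal_profConj hN αG (h : G) x).symm

end SemidirectProduct

theorem mainTheorem2_general {G : Type u} [Group G] [TopologicalSpace G] [IsTopologicalGroup G]
    (N H : Subgroup G) [N.Normal] (hNH : IsTopologicalSemidirectProduct N H)
    {PG PN PH : Type u}
    [Group PG] [TopologicalSpace PG] [IsProfiniteGroup PG]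
    [Group PN] [TopologicalSpace PN] [IsProfiniteGroup PN]
    [Group PH] [TopologicalSpace PH]
    (αG : G →ₜ* PG) (hG : IsProfiniteCompletion αG)
    (αN : N →ₜ* PN) (hN : IsProfiniteCompletion αN)
    (αH : H →ₜ* PH) (hH : IsProfiniteCompletion αH) :
    ((psi hN αG).toMonoidHom.ker = periodicKernel H hN ∧
      ∃ e : (PN ⧸ periodicKernel H hN) ≃ₜ* closureImage αG N,
        ∀ x : PN, e (x : PN ⧸ periodicKernel H hN) = psi hN αG x) ∧
    (∃ e : PH ≃ₜ* closureImage αG H, ∀ y : PH, e y = psi hH αG y) ∧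
    ((∀ h : H, (periodicKernel H hN).map (profAction H hN h).toMonoidHom = periodicKernel H hN) ∧
      ∃ θ : PH →* MulAut (PN ⧸ periodicKernel H hN),
        Continuous (fun p : PH × (PN ⧸ periodicKernel H hN) => θ p.1 p.2) ∧
        (∀ (h : H) (x : PN), θ (αH h) (x : PN ⧸ periodicKernel H hN) =
          (profAction H hN h x : PN ⧸ periodicKernel H hN)) ∧
        ∃ e : ((PN ⧸ periodicKernel H hN) ⋊[θ] PH) ≃ₜ* PG,
          ∀ (x : PN) (y : PH), e ⟨(x : PN ⧸ periodicKernel H hN), y⟩ =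
            (psi hN αG x : PG) * (psi hH αG y : PG)) := by
  have := hH.profinite
  have := closureImage_normal hG.denseRange N
  let ψN := quotientPeriodicKernelEquiv hNH hG hN
  let ψH := psiVal hH αG
  have prod_bijective : Function.Bijective (semidirectProductHom ψN ψH) :=
    ⟨semidirectProductHom_injective (r := (profRetraction hNH hG αH).toMonoidHom)
      (profRetraction_psiVal hNH hG hH) (closureImage_le_ker_profRetraction hNH hG αH),
    semidirectProductHom_surjective (dense_closureImage_mul_range_psiVal hNH hG.denseRange hH)⟩
  exact ⟨⟨ker_psi_eq_periodicKernel hNH hG hN, ψN, fun _ => rfl⟩,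
    ⟨psiEquiv hNH hG hH, fun _ => rfl⟩,
    map_profAction_periodicKernel hNH hG hN, conjAction ψN ψH, continuous_conjAction,
    conjAction_apply_mk hNH hG hN hH, continuousMulEquivOfBijective _ prod_bijective,
    fun _ _ => rfl⟩

theorem mainTheorem2 {G : Type u} [Group G] [TopologicalSpace G] [IsTopologicalGroup G]
    [LocallyCompactSpace G] [T2Space G]
    (N H : Subgroup G) [N.Normal] (hNH : IsTopologicalSemidirectProduct N H)
    {PG PN PH : Type u}
    [Group PG] [TopologicalSpace PG] [IsProfiniteGroup PG]
    [Group PN] [TopologicalSpace PN] [IsProfiniteGroup PN]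
    [Group PH] [TopologicalSpace PH] [IsProfiniteGroup PH]
    (αG : G →ₜ* PG) (hG : IsProfiniteCompletion αG)
    (αN : N →ₜ* PN) (hN : IsProfiniteCompletion αN)
    (αH : H →ₜ* PH) (hH : IsProfiniteCompletion αH) :
    -- (i)
    ((psi hN αG).toMonoidHom.ker = periodicKernel H hN ∧
      ∃ e : (PN ⧸ periodicKernel H hN) ≃ₜ* closureImage αG N,
        ∀ x : PN, e (x : PN ⧸ periodicKernel H hN) = psi hN αG x) ∧
    -- (ii)
    (∃ e : PH ≃ₜ* closureImage αG H, ∀ y : PH, e y = psi hH αG y) ∧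
    -- (iii)
    ((∀ h : H, (periodicKernel H hN).map (profAction H hN h).toMonoidHom = periodicKernel H hN) ∧
      ∃ θ : PH →* MulAut (PN ⧸ periodicKernel H hN),
        Continuous (fun p : PH × (PN ⧸ periodicKernel H hN) => θ p.1 p.2) ∧
        (∀ (h : H) (x : PN), θ (αH h) (x : PN ⧸ periodicKernel H hN) =
          (profAction H hN h x : PN ⧸ periodicKernel H hN)) ∧
        ∃ e : ((PN ⧸ periodicKernel H hN) ⋊[θ] PH) ≃ₜ* PG,
          ∀ (x : PN) (y : PH), e ⟨(x : PN ⧸ periodicKernel H hN), y⟩ =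
            (psi hN αG x : PG) * (psi hH αG y : PG)) :=
  mainTheorem2_general N H hNH αG hG αN hN αH hH
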